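/- Let $\mathbb D=\{z\in\mathbb C:|z|<1\}$ and let $\mathcal H$ be the set of holomorphic maps $\mathbb D\to\mathbb D$. A \emph{Blaschke product} is a function $f\in\mathcal H$ of the form \[ f(z)=\eta\prod_{n=1}^{N}\frac{|z_n|}{z_n}\,\frac{z_n-z}{1-\overline{z_n}\,z}\qquad(z\in\mathbb D), \] where $|\eta|=1$, $N\in\mathbb N\cup\{\infty\}$, $z_n\in\mathbb D$, $\sum_{n=1}^N(1-|z_n|)<\infty$, and $|z_n|/z_n:=1$ if $z_n=0$. A Blaschke product $f$ is \emph{indestructible} if $T\circ f$ is a Blaschke product for every conformal automorphism $T$ of $\mathbb D$. \textbf{Theorem.} Let $(b_n)_{n\ge 1}$ be a sequence in $\mathcal H$ and suppose that the forward iterates $B_n:=b_n\circ\cdots\circ b_1$ converge pointwise on $\mathbb D$ (equivalently, uniformly on compact subsets of $\mathbb D$) to a nonconstant limit $B\in\mathcal H$. Then the following are equivalent: (a) each $b_n$ is an indestructible Blaschke product; (b) $B$ is an indestructible Blaschke product. -/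

import Mathlib

noncomputable section

/-- The class of holomorphic self-maps of the open unit disk.
Functions are defined on all of `ℂ`, but only their values on the disk matter. -/
def IsDiskSelfMap (f : ℂ → ℂ) : Prop :=
  DifferentiableOn ℂ f (Metric.ball 0 1) ∧ Set.MapsTo f (Metric.ball 0 1) (Metric.ball 0 1)

/-- Conformal automorphisms of the unit disk: holomorphic self-maps with a holomorphic inverse. -/
def IsDiskAutomorphism (T : ℂ → ℂ) : Prop :=
  IsDiskSelfMap T ∧ ∃ S : ℂ → ℂ, IsDiskSelfMap S ∧
    Set.LeftInvOn S T (Metric.ball 0 1) ∧ Set.RightInvOn S T (Metric.ball 0 1)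

/-- The factor `(|a| / a) * (a - z) / (1 - conj a * z)`, where `|a| / a` is read as `1` if
`a = 0`. -/
def blaschkeFactor (a z : ℂ) : ℂ :=
  (if a = 0 then 1 else (‖a‖ : ℂ) / a) * ((a - z) / (1 - starRingEnd ℂ a * z))

/-- Finite and infinite Blaschke products: holomorphic self-maps of the disk of the form
`η * ∏ n < N, blaschkeFactor (a n) z` with `|η| = 1`, `N` a natural number or `∞`, and points
`a n` of the disk satisfying the Blaschke condition. Being a self-map of the open disk rules
out the unimodular constants, that is, the case `N = 0`. -/
def IsBlaschkeProduct (f : ℂ → ℂ) : Prop :=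
  IsDiskSelfMap f ∧ ∃ (η : ℂ) (N : ℕ∞) (a : ℕ → ℂ), ‖η‖ = 1 ∧
    (∀ n : ℕ, (n : ℕ∞) < N → a n ∈ Metric.ball (0 : ℂ) 1) ∧
    Summable (fun n : {n : ℕ // (n : ℕ∞) < N} => 1 - ‖a n‖) ∧
    ∀ z ∈ Metric.ball (0 : ℂ) 1,
      Multipliable (fun n : {n : ℕ // (n : ℕ∞) < N} => blaschkeFactor (a n) z) ∧
      f z = η * ∏' n : {n : ℕ // (n : ℕ∞) < N}, blaschkeFactor (a n) z

/-- A Blaschke product all of whose compositions `T ∘ f` with conformal automorphisms `T` of the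
disk are Blaschke products. -/
def IsIndestructibleBlaschkeProduct (f : ℂ → ℂ) : Prop :=
  IsBlaschkeProduct f ∧ ∀ T : ℂ → ℂ, IsDiskAutomorphism T → IsBlaschkeProduct (T ∘ f)

/-- The forward iterates `b n ∘ ⋯ ∘ b 1 ∘ b 0` (the sequence is indexed from `0`). -/
def forwardIterate (b : ℕ → ℂ → ℂ) : ℕ → ℂ → ℂ
  | 0 => b 0
  | n + 1 => b (n + 1) ∘ forwardIterate b n

end

/-!
The proof rests on the Lindelöf principle. Write `G z a` for Green's function of the disk
(`diskGreen`), and for a holomorphic self-map `f` let `L f w z` (`lindelofSum`) be the sum of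
`G z a` over the solutions `a` of `f a = w`, counted with multiplicity. Splitting off finitely many
zeros from the composition of `f` with an automorphism (`IsSchur.exists_eq_prod_mul`) shows
`L f w z ≤ G (f z) w`, see `lindelofSum_le_diskGreen`. A self-map is an indestructible Blaschke
product exactly if equality holds here for every `w`, and for each `w` it is enough to have
equality at one point `z` with `f z ≠ w`: see `isIndestructibleBlaschkeProduct_of_diskGreen_le` and
`IsIndestructibleBlaschkeProduct.diskGreen_le`.

Sorting the solutions of `g (h a) = w` by the value `c = h a` gives
`L (g ∘ h) w z = ∑ c, m c * L h c z`, where `m c` is the multiplicity of `c` as a solution of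
`g c = w` (`lindelofSum_comp`). Hence `g ∘ h` is an indestructible Blaschke product if and only if
both `g` and `h` are.

By Vitali's theorem the tails `b m ∘ ⋯ ∘ b (n + 1)` converge to self-maps `C n` with
`B = C n ∘ B n`, where `B n` is the forward iterate. If `B` is indestructible, then so is its right
factor `B n`, and therefore so is the left factor `b n` of `B n`. Conversely, let all `b n`, and
hence all `B n`, be indestructible. The maps `C n` tend to the identity, first on the open set
`B(𝔻)` by the Schwarz–Pick inequality and then on the disk by Vitali's theorem, so for large `n`
there are points `c n → w` with `C n (c n) = w`. It follows that
`L B w z ≥ L (B n) (c n) z = G (B n z) (c n) → G (B z) w`, which is equality in the Lindelöf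
principle for `B`.
-/

open Metric Set Filter Topology ComplexConjugate
open scoped ENNReal

/-- The open unit disk. -/
local notation "𝔻" => Metric.ball (0 : ℂ) 1

/-! ### Möbius involutions of the disk -/

/-- The automorphism of the disk that interchanges `a` and `0`. -/
noncomputable def diskInvolution (a z : ℂ) : ℂ := (a - z) / (1 - conj a * z)

lemma one_sub_conj_mul_ne_zero {a z : ℂ} (ha : a ∈ 𝔻) (hz : z ∈ 𝔻) : 1 - conj a * z ≠ 0 := by
  rw [mem_ball_zero_iff] at ha hz
  intro h
  have h1 : ‖conj a * z‖ = 1 := by rw [← sub_eq_zero.mp h, norm_one]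
  rw [norm_mul, RCLike.norm_conj] at h1
  nlinarith [norm_nonneg a, norm_nonneg z]

lemma one_sub_sq_norm_diskInvolution {a z : ℂ} (ha : a ∈ 𝔻) (hz : z ∈ 𝔻) :
    1 - ‖diskInvolution a z‖ ^ 2
      = (1 - ‖a‖ ^ 2) * (1 - ‖z‖ ^ 2) / ‖1 - conj a * z‖ ^ 2 := by
  have h := norm_pos_iff.mpr (one_sub_conj_mul_ne_zero ha hz)
  rw [diskInvolution, norm_div, div_pow, eq_div_iff (by positivity), sub_mul,
    div_mul_cancel₀ _ (by positivity)]
  simp only [← Complex.normSq_eq_norm_sq, Complex.normSq_apply]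
  simp
  ring

lemma norm_diskInvolution_lt_one {a z : ℂ} (ha : a ∈ 𝔻) (hz : z ∈ 𝔻) :
    ‖diskInvolution a z‖ < 1 := by
  have h := norm_pos_iff.mpr (one_sub_conj_mul_ne_zero ha hz)
  have h1 := one_sub_sq_norm_diskInvolution ha hz
  rw [mem_ball_zero_iff] at ha hz
  have h2 : 0 < (1 - ‖a‖ ^ 2) * (1 - ‖z‖ ^ 2) / ‖1 - conj a * z‖ ^ 2 := by
    have := norm_nonneg a
    have := norm_nonneg z
    have : 0 < 1 - ‖a‖ ^ 2 := by nlinarith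
    have : 0 < 1 - ‖z‖ ^ 2 := by nlinarith
    positivity
  nlinarith [norm_nonneg (diskInvolution a z)]

lemma mapsTo_diskInvolution {a : ℂ} (ha : a ∈ 𝔻) : MapsTo (diskInvolution a) 𝔻 𝔻 :=
  fun _ hz => mem_ball_zero_iff.mpr (norm_diskInvolution_lt_one ha hz)

lemma diskInvolution_diskInvolution {a z : ℂ} (ha : a ∈ 𝔻) (hz : z ∈ 𝔻) :
    diskInvolution a (diskInvolution a z) = z := by
  have h1 := one_sub_conj_mul_ne_zero ha hz
  have h2 := one_sub_conj_mul_ne_zero ha ha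
  have h3 := one_sub_conj_mul_ne_zero ha (mapsTo_diskInvolution ha hz)
  rw [diskInvolution, div_eq_iff h3]
  simp only [diskInvolution]
  generalize conj a = b at *
  rw [mul_comm b z] at h1
  field_simp
  ring

lemma differentiableOn_diskInvolution {a : ℂ} (ha : a ∈ 𝔻) :
    DifferentiableOn ℂ (diskInvolution a) 𝔻 := by
  unfold diskInvolution
  exact (by fun_prop : DifferentiableOn ℂ (fun z => a - z) 𝔻).div (by fun_prop)
    fun z hz => one_sub_conj_mul_ne_zero ha hz

lemma isDiskSelfMap_diskInvolution {a : ℂ} (ha : a ∈ 𝔻) : IsDiskSelfMap (diskInvolution a) :=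
  ⟨differentiableOn_diskInvolution ha, mapsTo_diskInvolution ha⟩

lemma isDiskAutomorphism_diskInvolution {a : ℂ} (ha : a ∈ 𝔻) :
    IsDiskAutomorphism (diskInvolution a) :=
  ⟨isDiskSelfMap_diskInvolution ha, diskInvolution a, isDiskSelfMap_diskInvolution ha,
    fun _ hz => diskInvolution_diskInvolution ha hz,
    fun _ hz => diskInvolution_diskInvolution ha hz⟩

@[simp] lemma diskInvolution_self (a : ℂ) : diskInvolution a a = 0 := by simp [diskInvolution]

@[simp] lemma diskInvolution_zero_right (a : ℂ) : diskInvolution a 0 = a := by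
  simp [diskInvolution]

@[simp] lemma diskInvolution_zero_left (z : ℂ) : diskInvolution 0 z = -z := by
  simp [diskInvolution]

lemma diskInvolution_eq_zero_iff {a z : ℂ} (ha : a ∈ 𝔻) (hz : z ∈ 𝔻) :
    diskInvolution a z = 0 ↔ z = a := by
  rw [diskInvolution, div_eq_zero_iff, or_iff_left (one_sub_conj_mul_ne_zero ha hz), sub_eq_zero,
    eq_comm]

lemma norm_blaschkeFactor (a z : ℂ) : ‖blaschkeFactor a z‖ = ‖diskInvolution a z‖ := by
  rw [blaschkeFactor, norm_mul, diskInvolution]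
  split_ifs with h
  · simp
  · simp [h]

lemma IsDiskSelfMap.comp {g h : ℂ → ℂ} (hg : IsDiskSelfMap g) (hh : IsDiskSelfMap h) :
    IsDiskSelfMap (g ∘ h) :=
  ⟨hg.1.comp hh.1 hh.2, hg.2.comp hh.2⟩

lemma analyticOrderAt_diskInvolution_self {a : ℂ} (ha : a ∈ 𝔻) :
    analyticOrderAt (diskInvolution a) a = 1 := by
  have h1 := one_sub_conj_mul_ne_zero ha ha
  have hg : AnalyticAt ℂ (fun z => -(1 - conj a * z)⁻¹) a := by fun_prop (disch := exact h1)
  have h2 : diskInvolution a = (· - a) * fun z => -(1 - conj a * z)⁻¹ := by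
    funext z
    simp only [diskInvolution, Pi.mul_apply, div_eq_mul_inv]
    ring
  rw [h2, analyticOrderAt_mul (by fun_prop) hg, analyticOrderAt_id_sub_const_self,
    hg.analyticOrderAt_eq_zero.mpr (by simpa using h1), add_zero]

/-! ### Schwarz–Pick estimates and division by zeros -/

/-- The Schur class: holomorphic maps of the open unit disk into the closed unit disk. -/
def IsSchur (f : ℂ → ℂ) : Prop :=
  DifferentiableOn ℂ f 𝔻 ∧ MapsTo f 𝔻 (closedBall 0 1)

lemma IsDiskSelfMap.isSchur {f : ℂ → ℂ} (hf : IsDiskSelfMap f) : IsSchur f :=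
  ⟨hf.1, hf.2.mono_right ball_subset_closedBall⟩

lemma IsSchur.norm_le {f : ℂ → ℂ} (hf : IsSchur f) {z : ℂ} (hz : z ∈ 𝔻) : ‖f z‖ ≤ 1 :=
  mem_closedBall_zero_iff.mp (hf.2 hz)

lemma IsSchur.comp {g h : ℂ → ℂ} (hg : IsSchur g) (hh : IsDiskSelfMap h) : IsSchur (g ∘ h) :=
  ⟨hg.1.comp hh.1 hh.2, hg.2.comp hh.2⟩

lemma IsSchur.norm_le_diskInvolution {f : ℂ → ℂ} (hf : IsSchur f) {a z : ℂ} (ha : a ∈ 𝔻)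
    (hz : z ∈ 𝔻) (h0 : f a = 0) : ‖f z‖ ≤ ‖diskInvolution a z‖ := by
  have hc := hf.comp (isDiskSelfMap_diskInvolution ha)
  have h := Complex.norm_le_norm_of_mapsTo_ball hc.1 hc.2 (by simp [h0])
    (norm_diskInvolution_lt_one ha hz)
  simpa [diskInvolution_diskInvolution ha hz] using h

/-- A zero of a Schur function splits off as a Blaschke factor, and the quotient is again a Schur
function. -/
lemma IsSchur.exists_eq_mul {f : ℂ → ℂ} (hf : IsSchur f) {a : ℂ} (ha : a ∈ 𝔻) (h0 : f a = 0) :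
    ∃ g, IsSchur g ∧ ∀ z ∈ 𝔻, f z = diskInvolution a z * g z := by
  have hnhds : 𝔻 ∈ 𝓝 a := isOpen_ball.mem_nhds ha
  set g : ℂ → ℂ := fun z => -(1 - conj a * z) * dslope f a z with hg
  have hgd : DifferentiableOn ℂ g 𝔻 :=
    (by fun_prop : DifferentiableOn ℂ (fun z => -(1 - conj a * z)) 𝔻).mul
      ((Complex.differentiableOn_dslope hnhds).mpr hf.1)
  have hfg : ∀ z ∈ 𝔻, f z = diskInvolution a z * g z := by
    intro z hz
    have h1 := one_sub_conj_mul_ne_zero ha hz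
    have h2 := sub_smul_dslope f a z
    rw [h0, sub_zero, smul_eq_mul] at h2
    rw [← h2, hg, diskInvolution, div_mul_eq_mul_div, eq_div_iff h1]
    ring
  have hne : ∀ z ∈ 𝔻, z ≠ a → ‖g z‖ ≤ 1 := by
    intro z hz hza
    have h1 : 0 < ‖diskInvolution a z‖ :=
      norm_pos_iff.mpr (mt (diskInvolution_eq_zero_iff ha hz).mp hza)
    have h2 := hf.norm_le_diskInvolution ha hz h0
    rw [hfg z hz, norm_mul] at h2
    exact le_of_mul_le_mul_left (by simpa using h2) h1
  refine ⟨g, ⟨hgd, fun z hz => mem_closedBall_zero_iff.mpr ?_⟩, hfg⟩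
  rcases eq_or_ne z a with rfl | hza
  · -- At the zero itself the bound follows by continuity.
    have hcont : Tendsto (fun w => ‖g w‖) (𝓝[≠] z) (𝓝 ‖g z‖) :=
      ((hgd.continuousOn.continuousAt hnhds).norm.tendsto).mono_left nhdsWithin_le_nhds
    refine le_of_tendsto hcont ?_
    filter_upwards [self_mem_nhdsWithin, nhdsWithin_le_nhds hnhds] with w hw hw'
    exact hne w hw' hw
  · exact hne z hz hza

/-- The Schwarz–Pick inequality. -/
lemma IsSchur.norm_sub_le {f : ℂ → ℂ} (hf : IsSchur f) {u v : ℂ} (hu : u ∈ 𝔻) (hv : v ∈ 𝔻) :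
    ‖f v - f u‖ ≤ ‖diskInvolution v u‖ * ‖1 - conj (f v) * f u‖ := by
  -- Scaling by `t < 1` makes the values lie in the open disk.
  have key : ∀ t ∈ Ioo (0 : ℝ) 1, ‖t * f v - t * f u‖
      ≤ ‖diskInvolution v u‖ * ‖1 - conj (t * f v) * (t * f u)‖ := by
    intro t ht
    have hmem : ∀ z ∈ 𝔻, (t : ℂ) * f z ∈ 𝔻 := by
      intro z hz
      rw [mem_ball_zero_iff, norm_mul, Complex.norm_real, Real.norm_of_nonneg ht.1.le]
      nlinarith [hf.norm_le hz, ht.1, ht.2]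
    have hF : IsDiskSelfMap (diskInvolution (t * f v) ∘ fun z => t * f z) :=
      (isDiskSelfMap_diskInvolution (hmem v hv)).comp ⟨hf.1.const_mul _, hmem⟩
    have h := hF.isSchur.norm_le_diskInvolution hv hu (by simp)
    have hpos := norm_pos_iff.mpr (one_sub_conj_mul_ne_zero (hmem v hv) (hmem u hu))
    rwa [Function.comp_apply, diskInvolution, norm_div, div_le_iff₀ hpos] at h
  have hl : Tendsto (fun t : ℝ => ‖t * f v - t * f u‖) (𝓝[<] 1) (𝓝 ‖f v - f u‖) := by
    have : ContinuousAt (fun t : ℝ => ‖t * f v - t * f u‖) 1 := by fun_prop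
    simpa using this.tendsto.mono_left nhdsWithin_le_nhds
  have hr : Tendsto (fun t : ℝ => ‖diskInvolution v u‖ * ‖1 - conj (t * f v) * (t * f u)‖)
      (𝓝[<] 1) (𝓝 (‖diskInvolution v u‖ * ‖1 - conj (f v) * f u‖)) := by
    have : ContinuousAt
        (fun t : ℝ => ‖diskInvolution v u‖ * ‖1 - conj (t * f v) * (t * f u)‖) 1 := by
      fun_prop
    simpa using this.tendsto.mono_left nhdsWithin_le_nhds
  refine le_of_tendsto_of_tendsto hl hr ?_
  filter_upwards [Ioo_mem_nhdsLT (zero_lt_one' ℝ)] with t ht using key t ht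

lemma IsSchur.norm_sub_le_two_mul {f : ℂ → ℂ} (hf : IsSchur f) {u v : ℂ} (hu : u ∈ 𝔻)
    (hv : v ∈ 𝔻) : ‖f v - f u‖ ≤ 2 * ‖diskInvolution v u‖ := by
  have h1 : ‖1 - conj (f v) * f u‖ ≤ 2 := by
    refine (_root_.norm_sub_le _ _).trans ?_
    rw [norm_one, norm_mul, RCLike.norm_conj]
    nlinarith [hf.norm_le hu, hf.norm_le hv, norm_nonneg (f u), norm_nonneg (f v)]
  have := hf.norm_sub_le hu hv
  nlinarith [norm_nonneg (diskInvolution v u)]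

/-- A Schur function whose value at `v` is nearly unimodular is nearly constant. -/
lemma IsSchur.norm_sub_le_of_near_unimodular {f : ℂ → ℂ} (hf : IsSchur f) {u v : ℂ}
    (hu : u ∈ 𝔻) (hv : v ∈ 𝔻) :
    ‖f v - f u‖ ≤ ‖diskInvolution v u‖ / (1 - ‖diskInvolution v u‖) * (1 - ‖f v‖ ^ 2) := by
  have h1 := norm_diskInvolution_lt_one hv hu
  have h2 := hf.norm_sub_le hu hv
  have h3 : ‖1 - conj (f v) * f u‖ ≤ (1 - ‖f v‖ ^ 2) + ‖f v - f u‖ := by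
    have e : 1 - conj (f v) * f u = ((1 - ‖f v‖ ^ 2 : ℝ) : ℂ) + conj (f v) * (f v - f u) := by
      push_cast
      rw [mul_sub, ← Complex.normSq_eq_conj_mul_self, Complex.normSq_eq_norm_sq]
      push_cast
      ring
    have h4 := hf.norm_le hv
    rw [e]
    refine (norm_add_le _ _).trans ?_
    rw [Complex.norm_real, Real.norm_of_nonneg (by nlinarith [norm_nonneg (f v)]), norm_mul,
      RCLike.norm_conj]
    nlinarith [norm_nonneg (f v - f u)]
  rw [div_mul_eq_mul_div, le_div_iff₀ (by linarith)]
  nlinarith [norm_nonneg (diskInvolution v u)]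

/-- A finite family of zeros, taken with at most their multiplicities, splits off from a Schur
function. -/
lemma IsSchur.exists_eq_prod_mul {ι : Type*} [DecidableEq ι] {a : ι → ℂ} (ha : ∀ i, a i ∈ 𝔻)
    (s : Finset ι) : ∀ {f : ℂ → ℂ}, IsSchur f →
    (∀ c ∈ 𝔻, ((s.filter fun i => a i = c).card : ℕ∞) ≤ analyticOrderAt f c) →
    ∃ g, IsSchur g ∧ ∀ z ∈ 𝔻, f z = (∏ i ∈ s, diskInvolution (a i) z) * g z := by
  induction s using Finset.induction_on with
  | empty => exact fun {f} hf _ => ⟨f, hf, by simp⟩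
  | insert j s hj ih =>
    intro f hf hord
    have h0 : f (a j) = 0 := by
      refine apply_eq_zero_of_analyticOrderAt_ne_zero fun h => ?_
      have := hord (a j) (ha j)
      rw [h, Finset.filter_insert, if_pos rfl] at this
      simp at this
    obtain ⟨f', hf', hff'⟩ := hf.exists_eq_mul (ha j) h0
    obtain ⟨g, hg, hfg⟩ := ih hf' fun c hc => by
      have hnhds : 𝔻 ∈ 𝓝 c := isOpen_ball.mem_nhds hc
      have hana := (differentiableOn_diskInvolution (ha j)).analyticAt hnhds
      have e : analyticOrderAt f c
          = analyticOrderAt (diskInvolution (a j)) c + analyticOrderAt f' c := by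
        rw [← analyticOrderAt_mul hana (hf'.1.analyticAt hnhds)]
        exact analyticOrderAt_congr (eventually_of_mem hnhds hff')
      have h := hord c hc
      rw [e, Finset.filter_insert] at h
      split_ifs at h with hjc
      · rw [Finset.card_insert_of_notMem (by simp [hj]), ← hjc,
          analyticOrderAt_diskInvolution_self (ha j), Nat.cast_add, Nat.cast_one, add_comm] at h
        rw [← hjc]
        exact (ENat.add_le_add_iff_left (by simp)).mp h
      · rwa [(hana.analyticOrderAt_eq_zero).mpr, zero_add] at h
        exact mt (diskInvolution_eq_zero_iff (ha j) hc).mp (Ne.symm hjc)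
    refine ⟨g, hg, fun z hz => ?_⟩
    rw [Finset.prod_insert hj, hff' z hz, hfg z hz, mul_assoc]

/-! ### Convergence of sequences of Schur functions -/

/-- Schur functions are equicontinuous, so pointwise convergence is locally uniform. -/
lemma tendstoLocallyUniformlyOn_of_isSchur {f : ℕ → ℂ → ℂ} {F : ℂ → ℂ} {U : Set ℂ}
    (hf : ∀ n, IsSchur (f n)) (hU : U ⊆ 𝔻)
    (hlim : ∀ z ∈ U, Tendsto (fun n => f n z) atTop (𝓝 (F z))) :
    TendstoLocallyUniformlyOn f F atTop U := by
  rw [Metric.tendstoLocallyUniformlyOn_iff]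
  intro ε hε x hx
  have hcont : Tendsto (fun y => 2 * ‖diskInvolution x y‖) (𝓝 x) (𝓝 0) := by
    have h1 := (differentiableOn_diskInvolution (hU hx)).continuousOn.continuousAt
      (isOpen_ball.mem_nhds (hU hx))
    simpa using (h1.norm.const_mul 2).tendsto
  refine ⟨{y | 2 * ‖diskInvolution x y‖ < ε / 3} ∩ U,
    inter_mem (nhdsWithin_le_nhds (hcont.eventually_lt_const (by positivity)))
      self_mem_nhdsWithin, ?_⟩
  have hx' : ∀ᶠ n in atTop, dist (f n x) (F x) < ε / 3 :=
    Metric.tendsto_nhds.mp (hlim x hx) _ (by positivity)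
  filter_upwards [hx'] with n hn y hy
  have h1 : ∀ m, dist (f m x) (f m y) ≤ ε / 3 := fun m => by
    rw [dist_eq_norm]
    exact ((hf m).norm_sub_le_two_mul (hU hy.2) (hU hx)).trans hy.1.le
  have h2 : dist (F x) (F y) ≤ ε / 3 :=
    le_of_tendsto ((hlim x hx).dist (hlim y hy.2)) (Eventually.of_forall h1)
  have h3 := dist_triangle4 (F y) (F x) (f n x) (f n y)
  linarith [h1 n, dist_comm (F y) (F x), dist_comm (F x) (f n x)]

lemma tendsto_iteratedDeriv_of_tendstoLocallyUniformlyOn {U : Set ℂ} (hU : IsOpen U) {z : ℂ}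
    (hz : z ∈ U) (k : ℕ) : ∀ {f : ℕ → ℂ → ℂ} {F : ℂ → ℂ},
    (∀ n, DifferentiableOn ℂ (f n) U) → TendstoLocallyUniformlyOn f F atTop U →
    Tendsto (fun n => iteratedDeriv k (f n) z) atTop (𝓝 (iteratedDeriv k F z)) := by
  induction k with
  | zero => exact fun _ h => by simpa using h.tendsto_at hz
  | succ k ih =>
    intro f F hf h
    simp only [iteratedDeriv_succ']
    exact ih (fun n => (hf n).deriv hU) (h.deriv (Eventually.of_forall hf) hU)

lemma IsSchur.norm_iteratedDeriv_le {f : ℂ → ℂ} (hf : IsSchur f) (k : ℕ) :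
    ‖iteratedDeriv k f 0‖ ≤ k.factorial := by
  have key : ∀ r ∈ Ioo (0 : ℝ) 1, ‖iteratedDeriv k f 0‖ * r ^ k ≤ k.factorial := by
    intro r hr
    have hsub : closedBall (0 : ℂ) r ⊆ 𝔻 := closedBall_subset_ball hr.2
    have h := Complex.norm_iteratedDeriv_le_of_forall_mem_sphere_norm_le (C := 1) k hr.1
      ((hf.1.mono hsub).diffContOnCl_ball subset_rfl)
      fun z hz => hf.norm_le (hsub (sphere_subset_closedBall hz))
    rwa [mul_one, le_div_iff₀ (pow_pos hr.1 k)] at h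
  have hl : Tendsto (fun r : ℝ => ‖iteratedDeriv k f 0‖ * r ^ k) (𝓝[<] 1)
      (𝓝 ‖iteratedDeriv k f 0‖) := by
    have : ContinuousAt (fun r : ℝ => ‖iteratedDeriv k f 0‖ * r ^ k) 1 := by fun_prop
    simpa using this.tendsto.mono_left nhdsWithin_le_nhds
  refine le_of_tendsto hl ?_
  filter_upwards [Ioo_mem_nhdsLT (zero_lt_one' ℝ)] with r hr using key r hr

/-- The Taylor coefficients at the origin converge and are at most one in modulus, so the power
series converge on the whole disk. -/
lemma exists_tendsto_of_isSchur_of_zero_mem {f : ℕ → ℂ → ℂ} (hf : ∀ n, IsSchur (f n)) {U : Set ℂ}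
    (hUo : IsOpen U) (hU : U ⊆ 𝔻) (h0 : (0 : ℂ) ∈ U)
    (hlim : ∀ z ∈ U, ∃ l, Tendsto (fun n => f n z) atTop (𝓝 l)) {z : ℂ} (hz : z ∈ 𝔻) :
    ∃ l, Tendsto (fun n => f n z) atTop (𝓝 l) := by
  choose! F hF using hlim
  have hloc := tendstoLocallyUniformlyOn_of_isSchur hf hU hF
  have hcoef := fun k => tendsto_iteratedDeriv_of_tendstoLocallyUniformlyOn hUo h0 k
    (fun n => (hf n).1.mono hU) hloc
  have hz1 : ‖z‖ < 1 := mem_ball_zero_iff.mp hz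
  refine ⟨∑' k : ℕ, ((k.factorial : ℂ)⁻¹ * z ^ k) * iteratedDeriv k F 0, ?_⟩
  have hsum : ∀ n, f n z = ∑' k : ℕ, ((k.factorial : ℂ)⁻¹ * z ^ k) * iteratedDeriv k (f n) 0 := by
    intro n
    have h := Complex.hasSum_taylorSeries_on_ball (hf n).1 hz
    simp only [sub_zero, smul_eq_mul, ← mul_assoc] at h
    exact h.tsum_eq.symm
  simp_rw [hsum]
  refine tendsto_tsum_of_dominated_convergence (summable_geometric_of_lt_one (norm_nonneg z) hz1)
    (fun k => (hcoef k).const_mul _) (Eventually.of_forall fun n k => ?_)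
  have h1 : (0 : ℝ) < k.factorial := by positivity
  rw [norm_mul, norm_mul, norm_inv, norm_pow, Complex.norm_natCast, mul_right_comm]
  refine mul_le_of_le_one_left (by positivity) ?_
  rw [inv_mul_le_iff₀ h1, mul_one]
  exact (hf n).norm_iteratedDeriv_le k

/-- Vitali's theorem for the Schur class. -/
theorem exists_tendstoLocallyUniformlyOn_of_isSchur {f : ℕ → ℂ → ℂ} (hf : ∀ n, IsSchur (f n))
    {U : Set ℂ} (hUo : IsOpen U) (hU : U ⊆ 𝔻) (hne : U.Nonempty)
    (hlim : ∀ z ∈ U, ∃ l, Tendsto (fun n => f n z) atTop (𝓝 l)) :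
    ∃ F, IsSchur F ∧ TendstoLocallyUniformlyOn f F atTop 𝔻 := by
  obtain ⟨p, hp⟩ := hne
  have hpD := hU hp
  have hpt : ∀ z ∈ 𝔻, ∃ l, Tendsto (fun n => f n z) atTop (𝓝 l) := by
    intro z hz
    have hopen : IsOpen (𝔻 ∩ diskInvolution p ⁻¹' U) :=
      (differentiableOn_diskInvolution hpD).continuousOn.isOpen_inter_preimage isOpen_ball hUo
    obtain ⟨l, hl⟩ := exists_tendsto_of_isSchur_of_zero_mem
      (fun n => (hf n).comp (isDiskSelfMap_diskInvolution hpD)) hopen inter_subset_left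
      ⟨by simp, by simpa using hp⟩ (fun w hw => hlim _ hw.2) (mapsTo_diskInvolution hpD hz)
    exact ⟨l, by simpa [diskInvolution_diskInvolution hpD hz] using hl⟩
  choose! F hF using hpt
  have hloc := tendstoLocallyUniformlyOn_of_isSchur hf subset_rfl hF
  exact ⟨F, ⟨hloc.differentiableOn (Eventually.of_forall fun n => (hf n).1) isOpen_ball,
    fun z hz => isClosed_closedBall.mem_of_tendsto (hF z hz)
      (Eventually.of_forall fun n => (hf n).2 hz)⟩, hloc⟩

/-! ### Green's function and the Lindelöf sum -/

/-- Green's function of the unit disk. On the diagonal, where Green's function is infinite, this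
definition gives the irrelevant value `0` instead. -/
noncomputable def diskGreen (z a : ℂ) : ℝ≥0∞ := ENNReal.ofReal (-Real.log ‖diskInvolution a z‖)

/-- The sum of Green's function at `z` over the solutions `a` of `f a = w` in the unit disk,
counted with multiplicity. -/
noncomputable def lindelofSum (f : ℂ → ℂ) (w z : ℂ) : ℝ≥0∞ :=
  ∑' a : 𝔻, ((analyticOrderAt (fun ζ => f ζ - w) a : ℕ∞) : ℝ≥0∞) * diskGreen z a

lemma norm_diskInvolution_pos {a z : ℂ} (ha : a ∈ 𝔻) (hz : z ∈ 𝔻) (hza : z ≠ a) :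
    0 < ‖diskInvolution a z‖ :=
  norm_pos_iff.mpr (mt (diskInvolution_eq_zero_iff ha hz).mp hza)

lemma diskGreen_ne_top (z a : ℂ) : diskGreen z a ≠ ∞ := ENNReal.ofReal_ne_top

lemma diskGreen_ne_zero {a z : ℂ} (ha : a ∈ 𝔻) (hz : z ∈ 𝔻) (hza : z ≠ a) :
    diskGreen z a ≠ 0 := by
  rw [diskGreen, Ne, ENNReal.ofReal_eq_zero, not_le, Left.neg_pos_iff]
  exact Real.log_neg (norm_diskInvolution_pos ha hz hza) (norm_diskInvolution_lt_one ha hz)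

lemma diskGreen_diskInvolution {u w : ℂ} : diskGreen (diskInvolution w u) 0 = diskGreen u w := by
  simp [diskGreen]

lemma continuousAt_diskGreen {u v : ℂ} (hu : u ∈ 𝔻) (hv : v ∈ 𝔻) (huv : u ≠ v) :
    ContinuousAt (fun p : ℂ × ℂ => diskGreen p.1 p.2) (u, v) := by
  unfold diskGreen
  refine ENNReal.continuous_ofReal.continuousAt.comp ?_
  have h1 : ContinuousAt (fun p : ℂ × ℂ => diskInvolution p.2 p.1) (u, v) := by
    unfold diskInvolution
    exact ContinuousAt.div (by fun_prop) (by fun_prop) (one_sub_conj_mul_ne_zero hv hu)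
  exact (h1.norm.log (norm_diskInvolution_pos hv hu huv).ne').neg

lemma lindelofSum_congr {f g : ℂ → ℂ} (h : EqOn f g 𝔻) (w z : ℂ) :
    lindelofSum f w z = lindelofSum g w z := by
  refine tsum_congr fun a => ?_
  rw [analyticOrderAt_congr (eventually_of_mem (isOpen_ball.mem_nhds a.2) fun ζ hζ => ?_)]
  simp only [h hζ]

lemma IsDiskSelfMap.analyticAt_sub {f : ℂ → ℂ} (hf : IsDiskSelfMap f) (w : ℂ) {a : ℂ}
    (ha : a ∈ 𝔻) : AnalyticAt ℂ (fun ζ => f ζ - w) a :=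
  (hf.1.analyticAt (isOpen_ball.mem_nhds ha)).sub analyticAt_const

/-- The solutions of `g (h a) = w`, sorted by the value `h a`. -/
lemma lindelofSum_comp {g h : ℂ → ℂ} (hg : IsDiskSelfMap g) (hh : IsDiskSelfMap h) (w z : ℂ) :
    lindelofSum (g ∘ h) w z = ∑' c : 𝔻,
      ((analyticOrderAt (fun ζ => g ζ - w) c : ℕ∞) : ℝ≥0∞) * lindelofSum h c z := by
  simp only [lindelofSum, ← ENNReal.tsum_mul_left]
  rw [ENNReal.tsum_comm]
  refine tsum_congr fun a => ?_
  have hha : h a ∈ 𝔻 := hh.2 a.2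
  rw [tsum_eq_single ⟨h a, hha⟩]
  · have hcomp := (hg.analyticAt_sub w hha).analyticOrderAt_comp
      (hh.1.analyticAt (isOpen_ball.mem_nhds a.2))
    have e : (fun ζ => (g ∘ h) ζ - w) = (fun ζ => g ζ - w) ∘ h := rfl
    rw [e, hcomp, ENat.toENNReal_mul, mul_assoc]
  · intro c hc
    have : analyticOrderAt (fun ζ => h ζ - c) a = 0 := by
      rw [(hh.analyticAt_sub c a.2).analyticOrderAt_eq_zero, sub_ne_zero]
      exact fun h' => hc (Subtype.ext h'.symm)
    simp [this]

lemma lindelofSum_le_lindelofSum_comp {g h : ℂ → ℂ} (hg : IsDiskSelfMap g) (hh : IsDiskSelfMap h)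
    {c w : ℂ} (hc : c ∈ 𝔻) (hcw : g c = w) (z : ℂ) :
    lindelofSum h c z ≤ lindelofSum (g ∘ h) w z := by
  rw [lindelofSum_comp hg hh]
  refine le_trans ?_ (ENNReal.le_tsum (⟨c, hc⟩ : 𝔻))
  have h1 : 1 ≤ analyticOrderAt (fun ζ => g ζ - w) c := by
    rw [Order.one_le_iff_ne_zero, (hg.analyticAt_sub w hc).analyticOrderAt_ne_zero, hcw, sub_self]
  have h2 : (1 : ℝ≥0∞) ≤ ((analyticOrderAt (fun ζ => g ζ - w) c : ℕ∞) : ℝ≥0∞) := by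
    rw [← ENat.toENNReal_one]
    exact ENat.toENNReal_le.mpr h1
  exact le_mul_of_one_le_left zero_le h2

/-- Postcomposition with `diskInvolution w` moves the value `w` to `0`. -/
lemma lindelofSum_diskInvolution_comp {f : ℂ → ℂ} (hf : IsDiskSelfMap f) {w : ℂ} (hw : w ∈ 𝔻)
    (z : ℂ) : lindelofSum (diskInvolution w ∘ f) 0 z = lindelofSum f w z := by
  have hφ := isDiskSelfMap_diskInvolution hw
  refine le_antisymm ?_ (lindelofSum_le_lindelofSum_comp hφ hf hw (by simp) z)
  refine (lindelofSum_le_lindelofSum_comp hφ (hφ.comp hf) (mem_ball_self one_pos) (by simp)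
    z).trans_eq (lindelofSum_congr (fun ζ hζ => ?_) w z)
  exact diskInvolution_diskInvolution hw (hf.2 hζ)

/-- The index type of the family of zeros of `f` in the disk, each zero `a` repeated as often as its
multiplicity. The zero with index `i` is `i.1`. -/
abbrev ZeroIndex (f : ℂ → ℂ) : Type := Σ a : 𝔻, Fin (analyticOrderNatAt f a)

lemma IsSchur.analyticOrderAt_ne_top {f : ℂ → ℂ} (hf : IsSchur f) {z a : ℂ} (hz : z ∈ 𝔻)
    (ha : a ∈ 𝔻) (hfz : f z ≠ 0) : analyticOrderAt f a ≠ ⊤ := by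
  have hana : AnalyticOnNhd ℂ f 𝔻 := hf.1.analyticOnNhd isOpen_ball
  refine hana.analyticOrderAt_ne_top_of_isPreconnected
    (convex_ball (0 : ℂ) 1).isPreconnected hz ha ?_
  rw [((hana z hz).analyticOrderAt_eq_zero).mpr hfz]
  simp

lemma lindelofSum_eq_tsum_zeroIndex {f : ℂ → ℂ} (hf : IsSchur f) {z₀ : ℂ} (hz₀ : z₀ ∈ 𝔻)
    (h0 : f z₀ ≠ 0) (z : ℂ) :
    lindelofSum f 0 z = ∑' i : ZeroIndex f, diskGreen z i.1 := by
  rw [ENNReal.tsum_sigma fun (a : 𝔻) (_ : Fin (analyticOrderNatAt f a)) => diskGreen z a,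
    lindelofSum]
  refine tsum_congr fun a => ?_
  have h1 := Nat.cast_analyticOrderNatAt (hf.analyticOrderAt_ne_top hz₀ a.2 h0)
  simp only [sub_zero]
  rw [← h1]
  simp

lemma card_filter_zeroIndex_le {f : ℂ → ℂ} (s : Finset (ZeroIndex f)) {c : ℂ} :
    ((s.filter fun i => (i.1 : ℂ) = c).card : ℕ∞) ≤ analyticOrderAt f c := by
  by_cases hc : c ∈ 𝔻
  swap
  · rw [Finset.filter_eq_empty_iff.mpr fun i _ h => hc (by rw [← h]; exact i.1.2)]
    simp
  have h1 : (s.filter fun i => (i.1 : ℂ) = c).card ≤ analyticOrderNatAt f c := by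
    have hsub : (s.filter fun i => (i.1 : ℂ) = c) ⊆
        Finset.univ.map (Function.Embedding.sigmaMk (⟨c, hc⟩ : 𝔻)) := by
      rintro ⟨a, k⟩ hi
      obtain rfl : a = ⟨c, hc⟩ := Subtype.ext (Finset.mem_filter.mp hi).2
      simp [Function.Embedding.sigmaMk]
    simpa using Finset.card_le_card hsub
  exact (Nat.cast_le.mpr h1).trans (ENat.natCast_toNat_le_self _)

lemma IsSchur.exists_eq_prod_zeroIndex_mul {f : ℂ → ℂ} (hf : IsSchur f)
    (s : Finset (ZeroIndex f)) :
    ∃ g, IsSchur g ∧ ∀ z ∈ 𝔻, f z = (∏ i ∈ s, diskInvolution i.1 z) * g z := by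
  classical
  exact IsSchur.exists_eq_prod_mul (fun i : ZeroIndex f => i.1.2) s hf
    fun _ _ => card_filter_zeroIndex_le s

lemma sum_diskGreen_eq_ofReal {ι : Type*} {a : ι → ℂ} {z : ℂ} (s : Finset ι)
    (ha : ∀ i ∈ s, a i ∈ 𝔻) (hz : z ∈ 𝔻) (hne : ∀ i ∈ s, z ≠ a i) :
    ∑ i ∈ s, diskGreen z (a i) =
      ENNReal.ofReal (-Real.log (∏ i ∈ s, ‖diskInvolution (a i) z‖)) := by
  unfold diskGreen
  rw [Real.log_prod fun i hi => (norm_diskInvolution_pos (ha i hi) hz (hne i hi)).ne',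
    ← Finset.sum_neg_distrib, ENNReal.ofReal_sum_of_nonneg]
  intro i hi
  exact neg_nonneg.mpr
    (Real.log_nonpos (norm_nonneg _) (norm_diskInvolution_lt_one (ha i hi) hz).le)

lemma ne_of_zeroIndex {f : ℂ → ℂ} {z : ℂ} (h0 : f z ≠ 0) (i : ZeroIndex f) : z ≠ i.1 := by
  rintro rfl
  obtain ⟨a, k⟩ := i
  exact h0 (apply_eq_zero_of_analyticOrderNatAt_ne_zero (Nat.ne_zero_of_lt k.2))

/-- The Lindelöf principle. -/
theorem lindelofSum_le_diskGreen {f : ℂ → ℂ} (hf : IsDiskSelfMap f) {w z : ℂ} (hw : w ∈ 𝔻)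
    (hz : z ∈ 𝔻) (hfz : f z ≠ w) : lindelofSum f w z ≤ diskGreen (f z) w := by
  set F := diskInvolution w ∘ f with hF
  have hFs : IsSchur F := ((isDiskSelfMap_diskInvolution hw).comp hf).isSchur
  have h0 : F z ≠ 0 := mt (diskInvolution_eq_zero_iff hw (hf.2 hz)).mp hfz
  rw [← lindelofSum_diskInvolution_comp hf hw, ← hF, lindelofSum_eq_tsum_zeroIndex hFs hz h0,
    ENNReal.tsum_eq_iSup_sum]
  refine iSup_le fun s => ?_
  have hne := fun i (_ : i ∈ s) => ne_of_zeroIndex h0 i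
  obtain ⟨g, hg, hFg⟩ := hFs.exists_eq_prod_zeroIndex_mul s
  rw [sum_diskGreen_eq_ofReal s (fun i _ => i.1.2) hz hne]
  refine ENNReal.ofReal_le_ofReal (neg_le_neg (Real.log_le_log (norm_pos_iff.mpr h0) ?_))
  change ‖F z‖ ≤ _
  rw [hFg z hz, norm_mul, norm_prod]
  exact mul_le_of_le_one_right (by positivity) (hg.norm_le hz)

/-! ### Blaschke products and equality in the Lindelöf principle at the value zero -/

lemma one_sub_norm_le_diskGreen {a z : ℂ} (ha : a ∈ 𝔻) (hz : z ∈ 𝔻) (hza : z ≠ a) :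
    1 - ‖a‖ ≤ 8 / (1 - ‖z‖ ^ 2) * (diskGreen z a).toReal := by
  have hx := norm_diskInvolution_pos ha hz hza
  have hx1 := norm_diskInvolution_lt_one ha hz
  have hsq := one_sub_sq_norm_diskInvolution ha hz
  have hlog := Real.log_le_sub_one_of_pos hx
  have hd := norm_pos_iff.mpr (one_sub_conj_mul_ne_zero ha hz)
  have hd2 : ‖1 - conj a * z‖ ≤ 2 := by
    refine (norm_sub_le _ _).trans ?_
    rw [norm_one, norm_mul, RCLike.norm_conj]
    rw [mem_ball_zero_iff] at ha hz
    nlinarith [norm_nonneg a, norm_nonneg z]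
  rw [mem_ball_zero_iff] at ha hz
  have hz2 : 0 < 1 - ‖z‖ ^ 2 := by nlinarith [norm_nonneg z]
  rw [diskGreen, ENNReal.toReal_ofReal (by linarith), div_mul_eq_mul_div, le_div_iff₀ hz2]
  rw [eq_div_iff (by positivity)] at hsq
  have h1 : (1 - ‖a‖) * (1 - ‖z‖ ^ 2) ≤ (1 - ‖a‖ ^ 2) * (1 - ‖z‖ ^ 2) :=
    mul_le_mul_of_nonneg_right (by nlinarith [norm_nonneg a]) hz2.le
  have h2 : (1 - ‖diskInvolution a z‖ ^ 2) * ‖1 - conj a * z‖ ^ 2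
      ≤ (1 - ‖diskInvolution a z‖ ^ 2) * 4 :=
    mul_le_mul_of_nonneg_left (by nlinarith) (by nlinarith)
  nlinarith

/-- The unimodular constant that normalizes a Blaschke factor. -/
noncomputable def blaschkeUnit (a : ℂ) : ℂ := if a = 0 then 1 else (‖a‖ : ℂ) / a

lemma norm_blaschkeUnit (a : ℂ) : ‖blaschkeUnit a‖ = 1 := by
  rw [blaschkeUnit]
  split_ifs with h <;> simp [h]

lemma blaschkeFactor_eq (a z : ℂ) : blaschkeFactor a z = blaschkeUnit a * diskInvolution a z := rfl

lemma norm_blaschkeFactor_sub_one_le {a z : ℂ} (ha : a ∈ 𝔻) (hz : z ∈ 𝔻) :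
    ‖blaschkeFactor a z - 1‖ ≤ 2 / (1 - ‖z‖) * (1 - ‖a‖) := by
  have hne := one_sub_conj_mul_ne_zero ha hz
  have hd := norm_pos_iff.mpr hne
  have hd2 : 1 - ‖z‖ ≤ ‖1 - conj a * z‖ := by
    have h := norm_sub_norm_le (1 : ℂ) (conj a * z)
    rw [norm_one, norm_mul, RCLike.norm_conj] at h
    rw [mem_ball_zero_iff] at ha hz
    nlinarith [norm_nonneg a, norm_nonneg z]
  rw [mem_ball_zero_iff] at ha hz
  have hz1 : 0 < 1 - ‖z‖ := by linarith
  rcases eq_or_ne a 0 with rfl | ha0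
  · have h1 : ‖-z - 1‖ ≤ 2 := by
      refine (norm_sub_le _ _).trans ?_
      rw [norm_neg, norm_one]
      linarith
    have h2 : 2 ≤ 2 / (1 - ‖z‖) := by
      rw [le_div_iff₀ hz1]
      nlinarith [norm_nonneg z]
    simpa [blaschkeFactor] using h1.trans h2
  · have hu : blaschkeUnit a = ‖a‖ / a := by rw [blaschkeUnit, if_neg ha0]
    have e : blaschkeFactor a z - 1 =
        -(((1 - ‖a‖ : ℝ) : ℂ) * (blaschkeUnit a * z + 1)) / (1 - conj a * z) := by
      have hsq : conj a = (‖a‖ : ℂ) ^ 2 / a := by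
        rw [eq_div_iff ha0, ← Complex.normSq_eq_conj_mul_self, Complex.normSq_eq_norm_sq]
        push_cast
        rfl
      rw [blaschkeFactor_eq, diskInvolution, eq_div_iff hne, sub_mul, ← mul_div_assoc,
        div_mul_cancel₀ _ hne, hu, hsq]
      field_simp
      push_cast
      ring
    have h1 : ‖blaschkeUnit a * z + 1‖ ≤ 2 := by
      refine (norm_add_le _ _).trans ?_
      rw [norm_mul, norm_blaschkeUnit, norm_one]
      linarith
    rw [e, norm_div, norm_neg, norm_mul, Complex.norm_real,
      Real.norm_of_nonneg (by linarith), div_mul_eq_mul_div, div_le_div_iff₀ hd hz1]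
    have h2 : (1 - ‖a‖) * ‖blaschkeUnit a * z + 1‖ ≤ 2 * (1 - ‖a‖) := by nlinarith
    exact mul_le_mul h2 hd2 hz1.le (by linarith)

lemma multipliable_blaschkeFactor {ι : Type*} {a : ι → ℂ} (ha : ∀ i, a i ∈ 𝔻)
    (hsum : Summable fun i => 1 - ‖a i‖) {z : ℂ} (hz : z ∈ 𝔻) :
    Multipliable fun i => blaschkeFactor (a i) z := by
  have h : Summable fun i => ‖blaschkeFactor (a i) z - 1‖ :=
    Summable.of_nonneg_of_le (fun _ => norm_nonneg _)
      (fun i => norm_blaschkeFactor_sub_one_le (ha i) hz) (hsum.mul_left _)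
  simpa using multipliable_one_add_of_summable h

lemma IsSchur.exists_eq_prod_blaschkeFactor_mul {f : ℂ → ℂ} (hf : IsSchur f)
    (s : Finset (ZeroIndex f)) :
    ∃ g, IsSchur g ∧ ∀ z ∈ 𝔻, f z = (∏ i ∈ s, blaschkeFactor i.1 z) * g z := by
  obtain ⟨g, hg, hfg⟩ := hf.exists_eq_prod_zeroIndex_mul s
  set u : ℂ := ∏ i ∈ s, blaschkeUnit i.1 with hu
  have hu1 : ‖u‖ = 1 := by simp [hu, norm_blaschkeUnit]
  have hu0 : u ≠ 0 := norm_pos_iff.mp (by simp [hu1])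
  refine ⟨fun z => u⁻¹ * g z, ⟨hg.1.const_mul _, fun z hz => ?_⟩, fun z hz => ?_⟩
  · rw [mem_closedBall_zero_iff, norm_mul, norm_inv, hu1, inv_one, one_mul]
    exact hg.norm_le hz
  · simp only [blaschkeFactor_eq, Finset.prod_mul_distrib, ← hu]
    rw [hfg z hz]
    field_simp

lemma exists_equiv_of_countable (ι : Type*) [Countable ι] :
    ∃ N : ℕ∞, Nonempty ({n : ℕ // (n : ℕ∞) < N} ≃ ι) := by
  rcases finite_or_infinite ι with h | h
  · obtain ⟨n, ⟨e⟩⟩ := Finite.exists_equiv_fin ι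
    refine ⟨n, ⟨Equiv.trans ?_ e.symm⟩⟩
    exact (Equiv.subtypeEquivRight fun m => by simp).trans Fin.equivSubtype.symm
  · obtain ⟨e⟩ := nonempty_denumerable ι
    exact ⟨⊤, ⟨(Equiv.subtypeUnivEquiv fun m => by simp).trans (Denumerable.eqv ι).symm⟩⟩

/-- It does not matter which countable set indexes the zeros of a Blaschke product. -/
lemma IsDiskSelfMap.isBlaschkeProduct_of_countable {f : ℂ → ℂ} (hf : IsDiskSelfMap f)
    {ι : Type*} [Countable ι] {a : ι → ℂ} (ha : ∀ i, a i ∈ 𝔻)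
    (hsum : Summable fun i => 1 - ‖a i‖) {η : ℂ} (hη : ‖η‖ = 1)
    (hfa : ∀ z ∈ 𝔻, f z = η * ∏' i, blaschkeFactor (a i) z) : IsBlaschkeProduct f := by
  obtain ⟨N, ⟨e⟩⟩ := exists_equiv_of_countable ι
  set a' : ℕ → ℂ := fun n => if h : (n : ℕ∞) < N then a (e ⟨n, h⟩) else 0 with ha'
  have haa : ∀ n : {n : ℕ // (n : ℕ∞) < N}, a' n = a (e n) := fun n => by
    simp [ha', n.2]
  refine ⟨hf, η, N, a', hη, fun n hn => (haa ⟨n, hn⟩).symm ▸ ha _, ?_, fun z hz => ?_⟩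
  · simp only [haa]
    exact (e.summable_iff (f := fun i => 1 - ‖a i‖)).mpr hsum
  · simp only [haa]
    refine ⟨(e.multipliable_iff (f := fun i => blaschkeFactor (a i) z)).mpr
      (multipliable_blaschkeFactor ha hsum hz), ?_⟩
    rw [e.tprod_eq (fun i => blaschkeFactor (a i) z)]
    exact hfa z hz

/-- If the zeros of `f` account for the size of `f` at a single point, then `f` is a Blaschke
product. Indeed, the quotients of `f` by its finite partial products are Schur functions whose
values at that point tend to a unimodular number, so that they converge to a constant. -/
theorem isBlaschkeProduct_of_diskGreen_le {f : ℂ → ℂ} (hf : IsDiskSelfMap f) {z₀ : ℂ}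
    (hz₀ : z₀ ∈ 𝔻) (h0 : f z₀ ≠ 0) (hle : diskGreen (f z₀) 0 ≤ lindelofSum f 0 z₀) :
    IsBlaschkeProduct f := by
  have hD0 : (0 : ℂ) ∈ 𝔻 := mem_ball_self one_pos
  have hs := hf.isSchur
  have hfin : ∑' i : ZeroIndex f, diskGreen z₀ i.1 ≠ ∞ := by
    rw [← lindelofSum_eq_tsum_zeroIndex hs hz₀ h0]
    exact ((lindelofSum_le_diskGreen hf hD0 hz₀ h0).trans_lt (diskGreen_ne_top _ _).lt_top).ne
  have hne := fun i : ZeroIndex f => ne_of_zeroIndex h0 i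
  -- A convergent sum has only countably many nonzero terms, and here no term vanishes.
  have hcount : Countable (ZeroIndex f) := by
    have h := Summable.countable_support_ennreal hfin
    rw [Function.support_eq_univ fun i : ZeroIndex f => diskGreen_ne_zero i.1.2 hz₀ (hne i)] at h
    exact countable_univ_iff.mp h
  have hsum : Summable fun i : ZeroIndex f => 1 - ‖(i.1 : ℂ)‖ :=
    Summable.of_nonneg_of_le
      (fun i => sub_nonneg.mpr (mem_ball_zero_iff.mp i.1.2).le)
      (fun i => one_sub_norm_le_diskGreen i.1.2 hz₀ (hne i))
      ((ENNReal.summable_toReal hfin).mul_left _)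
  choose g hg hfg using hs.exists_eq_prod_blaschkeFactor_mul
  set P : Finset (ZeroIndex f) → ℂ → ℂ := fun s z => ∏ i ∈ s, blaschkeFactor i.1 z with hP
  set Q : ℂ → ℂ := fun z => ∏' i : ZeroIndex f, blaschkeFactor i.1 z with hQ
  have hPQ : ∀ z ∈ 𝔻, Tendsto (fun s => P s z) atTop (𝓝 (Q z)) := fun z hz =>
    (multipliable_blaschkeFactor (fun i : ZeroIndex f => i.1.2) hsum hz).hasProd
  have hnorm : ∀ s, ‖P s z₀‖ = ∏ i ∈ s, ‖diskInvolution i.1 z₀‖ := fun s => by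
    simp [hP, norm_blaschkeFactor]
  have hP0 : ∀ s, P s z₀ ≠ 0 := fun s h => h0 (by rw [hfg s z₀ hz₀]; exact mul_eq_zero_of_left h _)
  have hfP : ‖f z₀‖ ≤ ‖Q z₀‖ := by
    refine ge_of_tendsto (hPQ z₀ hz₀).norm (Eventually.of_forall fun s => ?_)
    rw [hfg s z₀ hz₀, norm_mul]
    exact mul_le_of_le_one_right (norm_nonneg _) ((hg s).norm_le hz₀)
  have hQ0 : Q z₀ ≠ 0 := norm_pos_iff.mp ((norm_pos_iff.mpr h0).trans_le hfP)
  -- The logarithm of the infinite product at `z₀` is minus the Lindelöf sum.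
  have hQf : ‖Q z₀‖ ≤ ‖f z₀‖ := by
    have h1 : Tendsto (fun s : Finset (ZeroIndex f) => ∑ i ∈ s, diskGreen z₀ i.1) atTop
        (𝓝 (∑' i : ZeroIndex f, diskGreen z₀ i.1)) := ENNReal.summable.hasSum
    have h2 : Tendsto (fun s => ENNReal.ofReal (-Real.log ‖P s z₀‖)) atTop
        (𝓝 (ENNReal.ofReal (-Real.log ‖Q z₀‖))) :=
      ENNReal.tendsto_ofReal ((hPQ z₀ hz₀).norm.log (norm_ne_zero_iff.mpr hQ0)).neg
    have h3 := tendsto_nhds_unique h1 (h2.congr fun s => by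
      rw [hnorm, sum_diskGreen_eq_ofReal s (fun i _ => i.1.2) hz₀ fun i _ => hne i])
    rw [lindelofSum_eq_tsum_zeroIndex hs hz₀ h0, h3, diskGreen, diskInvolution_zero_left,
      norm_neg] at hle
    have hf1 : 0 < -Real.log ‖f z₀‖ := neg_pos.mpr
      (Real.log_neg (norm_pos_iff.mpr h0) (mem_ball_zero_iff.mp (hf.2 hz₀)))
    rw [ENNReal.ofReal_le_ofReal_iff' , or_iff_left (not_le.mpr hf1), neg_le_neg_iff] at hle
    exact (Real.log_le_log_iff (norm_pos_iff.mpr hQ0) (norm_pos_iff.mpr h0)).mp hle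
  set η : ℂ := f z₀ / Q z₀ with hη
  have hη1 : ‖η‖ = 1 := by
    rw [hη, norm_div, le_antisymm hfP hQf, div_self (norm_ne_zero_iff.mpr hQ0)]
  have hgη : Tendsto (fun s => g s z₀) atTop (𝓝 η) := by
    refine (tendsto_const_nhds.div (hPQ z₀ hz₀) hQ0).congr fun s => ?_
    rw [Pi.div_apply, div_eq_iff (hP0 s), hfg s z₀ hz₀, mul_comm]
  refine hf.isBlaschkeProduct_of_countable (fun i : ZeroIndex f => i.1.2) hsum hη1 fun z hz => ?_
  -- The quotients are nearly unimodular at `z₀`, hence nearly constant.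
  have hdiff : Tendsto (fun s => g s z₀ - g s z) atTop (𝓝 0) := by
    refine squeeze_zero_norm
      (fun s => (hg s).norm_sub_le_of_near_unimodular hz hz₀) ?_
    have h := ((hgη.norm.pow 2).const_sub 1).const_mul
      (‖diskInvolution z₀ z‖ / (1 - ‖diskInvolution z₀ z‖))
    simpa [hη1] using h
  have hgz : Tendsto (fun s => g s z) atTop (𝓝 η) := by simpa using hgη.sub hdiff
  have hlim := (hgz.mul (hPQ z hz)).congr fun s => by rw [mul_comm, ← hfg s z hz]
  exact tendsto_nhds_unique tendsto_const_nhds hlim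

/-- A bound by the `k`-th power of a Blaschke factor makes `c` a zero of order at least `k`. -/
lemma le_analyticOrderAt_of_norm_le_pow {c : ℂ} (hc : c ∈ 𝔻) (k : ℕ) : ∀ {f : ℂ → ℂ},
    IsSchur f → (∀ z ∈ 𝔻, ‖f z‖ ≤ ‖diskInvolution c z‖ ^ k) → (k : ℕ∞) ≤ analyticOrderAt f c := by
  have hnhds : 𝔻 ∈ 𝓝 c := isOpen_ball.mem_nhds hc
  have hφ := differentiableOn_diskInvolution hc
  induction k with
  | zero => simp
  | succ k ih =>
    intro f hf hle
    have h0 : f c = 0 := by simpa using hle c hc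
    obtain ⟨g, hg, hfg⟩ := hf.exists_eq_mul hc h0
    have hne : ∀ z ∈ 𝔻, z ≠ c → ‖g z‖ ≤ ‖diskInvolution c z‖ ^ k := fun z hz hzc => by
      have h := hle z hz
      rw [hfg z hz, norm_mul, pow_succ'] at h
      exact le_of_mul_le_mul_left h (norm_diskInvolution_pos hc hz hzc)
    have hgle : ∀ z ∈ 𝔻, ‖g z‖ ≤ ‖diskInvolution c z‖ ^ k := by
      intro z hz
      rcases eq_or_ne z c with rfl | hzc
      · have hl := ((hg.1.continuousOn.continuousAt hnhds).norm.tendsto).mono_left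
          (nhdsWithin_le_nhds (s := {z}ᶜ))
        have hr := (((hφ.continuousOn.continuousAt hnhds).norm.pow k).tendsto).mono_left
          (nhdsWithin_le_nhds (s := {z}ᶜ))
        refine le_of_tendsto_of_tendsto hl hr ?_
        filter_upwards [self_mem_nhdsWithin, nhdsWithin_le_nhds hnhds] with w hw hw'
        exact hne w hw' hw
      · exact hne z hz hzc
    have e : analyticOrderAt f c = 1 + analyticOrderAt g c := by
      rw [← analyticOrderAt_diskInvolution_self hc,
        ← analyticOrderAt_mul (hφ.analyticAt hnhds) (hg.1.analyticAt hnhds)]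
      exact analyticOrderAt_congr (eventually_of_mem hnhds hfg)
    rw [e, Nat.cast_add, Nat.cast_one, add_comm]
    gcongr
    exact ih hg hgle

/-- In a Blaschke product the zeros account for the size of the function at every point. -/
theorem IsBlaschkeProduct.diskGreen_le {f : ℂ → ℂ} (hf : IsBlaschkeProduct f) {z : ℂ} (hz : z ∈ 𝔻)
    (h0 : f z ≠ 0) : diskGreen (f z) 0 ≤ lindelofSum f 0 z := by
  classical
  obtain ⟨hself, η, N, a, hη, haN, -, hprod⟩ := hf
  set α : {n : ℕ // (n : ℕ∞) < N} → 𝔻 := fun n => ⟨a n, haN n n.2⟩ with hα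
  have hlim : ∀ ζ ∈ 𝔻, Tendsto (fun s => ∏ i ∈ s, ‖diskInvolution (α i) ζ‖) atTop
      (𝓝 ‖f ζ‖) := fun ζ hζ => by
    have h : Tendsto (fun s => ‖η * ∏ i ∈ s, blaschkeFactor (α i) ζ‖) atTop (𝓝 ‖f ζ‖) := by
      rw [(hprod ζ hζ).2]
      exact ((hprod ζ hζ).1.hasProd.const_mul η).norm
    simpa [norm_blaschkeFactor, hη] using h
  have hle1 : ∀ i, ∀ ζ ∈ 𝔻, ‖diskInvolution (α i) ζ‖ ≤ 1 := fun i ζ hζ =>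
    (norm_diskInvolution_lt_one (α i).2 hζ).le
  have hle : ∀ s : Finset {n : ℕ // (n : ℕ∞) < N}, ∀ ζ ∈ 𝔻,
      ‖f ζ‖ ≤ ∏ i ∈ s, ‖diskInvolution (α i) ζ‖ := fun s ζ hζ => by
    refine le_of_tendsto (hlim ζ hζ) ?_
    filter_upwards [eventually_ge_atTop s] with t hst
    rw [← Finset.prod_sdiff hst]
    exact mul_le_of_le_one_left (Finset.prod_nonneg fun i _ => norm_nonneg _)
      (Finset.prod_le_one (fun i _ => norm_nonneg _) fun i _ => hle1 i ζ hζ)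
  have hcard : ∀ (s : Finset {n : ℕ // (n : ℕ∞) < N}) (c : 𝔻),
      ((s.filter fun i => α i = c).card : ℕ∞) ≤ analyticOrderAt f c := fun s c => by
    refine le_analyticOrderAt_of_norm_le_pow c.2 _ hself.isSchur fun ζ hζ => ?_
    refine (hle (s.filter fun i => α i = c) ζ hζ).trans_eq ?_
    rw [← Finset.prod_const]
    refine Finset.prod_congr rfl fun i hi => ?_
    rw [(Finset.mem_filter.mp hi).2]
  have hne : ∀ i, z ≠ α i := fun i hi => by
    have h := hle {i} z hz
    rw [Finset.prod_singleton, ← hi, diskInvolution_self, norm_zero] at h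
    exact h0 (norm_le_zero_iff.mp h)
  have hsum : ∀ s : Finset {n : ℕ // (n : ℕ∞) < N},
      ∑ i ∈ s, diskGreen z (α i) ≤ lindelofSum f 0 z := fun s => by
    rw [Finset.sum_comp (fun c : 𝔻 => diskGreen z c) α]
    refine le_trans (Finset.sum_le_sum fun c _ => ?_) (ENNReal.sum_le_tsum (s.image α))
    rw [nsmul_eq_mul]
    gcongr
    rw [← ENat.toENNReal_coe]
    simpa only [sub_zero] using ENat.toENNReal_le.mpr (hcard s c)
  have hlog : Tendsto (fun s : Finset {n : ℕ // (n : ℕ∞) < N} => ∑ i ∈ s, diskGreen z (α i))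
      atTop (𝓝 (diskGreen (f z) 0)) := by
    rw [diskGreen, diskInvolution_zero_left, norm_neg]
    refine (ENNReal.tendsto_ofReal
      ((hlim z hz).log (norm_ne_zero_iff.mpr h0)).neg).congr fun s => ?_
    rw [sum_diskGreen_eq_ofReal s (fun i _ => (α i).2) hz fun i _ => hne i]
  exact le_of_tendsto hlog (Eventually.of_forall hsum)

/-! ### Indestructibility as equality in the Lindelöf principle -/

/-- A disk automorphism `T` changes modulus as the involution at the zero of `T` does. -/
lemma IsDiskAutomorphism.exists_norm_eq {T : ℂ → ℂ} (hT : IsDiskAutomorphism T) :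
    ∃ w ∈ 𝔻, T w = 0 ∧ ∀ u ∈ 𝔻, ‖T u‖ = ‖diskInvolution w u‖ := by
  obtain ⟨hT, S, hS, hST, hTS⟩ := hT
  have h0 : (0 : ℂ) ∈ 𝔻 := mem_ball_self one_pos
  have hw := hS.2 h0
  refine ⟨S 0, hw, hTS h0, fun u hu =>
    le_antisymm (hT.isSchur.norm_le_diskInvolution hw hu (hTS h0)) ?_⟩
  have h := (((isDiskSelfMap_diskInvolution hw).comp hS).isSchur).norm_le_diskInvolution h0
    (hT.2 hu) (by simp)
  simpa [hST hu] using h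

/-- Equality in the Lindelöf principle at a single point, for every value `w`, suffices for
indestructibility. -/
theorem isIndestructibleBlaschkeProduct_of_diskGreen_le {f : ℂ → ℂ} (hf : IsDiskSelfMap f)
    (h : ∀ w ∈ 𝔻, ∃ z ∈ 𝔻, f z ≠ w ∧ diskGreen (f z) w ≤ lindelofSum f w z) :
    IsIndestructibleBlaschkeProduct f := by
  constructor
  · obtain ⟨z, hz, h0, hle⟩ := h 0 (mem_ball_self one_pos)
    exact isBlaschkeProduct_of_diskGreen_le hf hz h0 hle
  · intro T hT
    obtain ⟨w, hw, hTw, hnorm⟩ := hT.exists_norm_eq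
    obtain ⟨z, hz, h0, hle⟩ := h w hw
    have hz' : ‖T (f z)‖ = ‖diskInvolution w (f z)‖ := hnorm _ (hf.2 hz)
    refine isBlaschkeProduct_of_diskGreen_le (hT.1.comp hf) hz ?_ ?_
    · exact norm_pos_iff.mp (hz' ▸ norm_diskInvolution_pos hw (hf.2 hz) h0)
    · refine le_trans ?_ (lindelofSum_le_lindelofSum_comp hT.1 hf hw hTw z)
      refine le_trans (le_of_eq ?_) hle
      simp [diskGreen, hz']

/-- Equality in the Lindelöf principle holds everywhere for an indestructible Blaschke product. -/
theorem IsIndestructibleBlaschkeProduct.diskGreen_le {f : ℂ → ℂ}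
    (hf : IsIndestructibleBlaschkeProduct f) {w z : ℂ} (hw : w ∈ 𝔻) (hz : z ∈ 𝔻) (h : f z ≠ w) :
    diskGreen (f z) w ≤ lindelofSum f w z := by
  have hself := hf.1.1
  rw [← lindelofSum_diskInvolution_comp hself hw, ← diskGreen_diskInvolution]
  exact (hf.2 _ (isDiskAutomorphism_diskInvolution hw)).diskGreen_le hz
    (mt (diskInvolution_eq_zero_iff hw (hself.2 hz)).mp h)

/-- Indestructible Blaschke products are not constant. -/
lemma IsIndestructibleBlaschkeProduct.exists_ne {f : ℂ → ℂ}
    (hf : IsIndestructibleBlaschkeProduct f) (w : ℂ) : ∃ z ∈ 𝔻, f z ≠ w := by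
  by_contra! hconst
  have hself := hf.1.1
  have h0 : (0 : ℂ) ∈ 𝔻 := mem_ball_self one_pos
  obtain ⟨v, hv, hvw⟩ : ∃ v ∈ 𝔻, v ≠ w := by
    rcases eq_or_ne w 0 with rfl | hw
    · exact ⟨1 / 2, by rw [mem_ball_zero_iff]; norm_num, by norm_num⟩
    · exact ⟨0, h0, hw.symm⟩
  -- A constant function does not attain the value `v`, so its Lindelöf sum at `v` vanishes.
  have hz : f 0 ≠ v := by rw [hconst 0 h0]; exact hvw.symm
  have hle := hf.diskGreen_le hv h0 hz
  have hsum : lindelofSum f v 0 = 0 := ENNReal.tsum_eq_zero.mpr fun a => by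
    have : analyticOrderAt (fun ζ => f ζ - v) a = 0 := by
      rw [(hself.analyticAt_sub v a.2).analyticOrderAt_eq_zero, sub_ne_zero, hconst a a.2]
      exact hvw.symm
    simp [this]
  rw [hsum] at hle
  exact diskGreen_ne_zero hv (hself.2 h0) hz (le_antisymm hle zero_le)

lemma IsIndestructibleBlaschkeProduct.congr {f g : ℂ → ℂ} (hf : IsIndestructibleBlaschkeProduct f)
    (h : EqOn f g 𝔻) : IsIndestructibleBlaschkeProduct g := by
  have hg : IsDiskSelfMap g := ⟨hf.1.1.1.congr h.symm, hf.1.1.2.congr h⟩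
  refine isIndestructibleBlaschkeProduct_of_diskGreen_le hg fun w hw => ?_
  obtain ⟨z, hz, hne⟩ := hf.exists_ne w
  refine ⟨z, hz, h hz ▸ hne, ?_⟩
  rw [← h hz, ← lindelofSum_congr h]
  exact hf.diskGreen_le hw hz hne

/-- The Lindelöf principle for `h`, applied to each term of the decomposition `lindelofSum_comp`,
gives the corresponding term of the Lindelöf sum of `g` at `h z`. -/
lemma order_mul_lindelofSum_le {g h : ℂ → ℂ} (hg : IsDiskSelfMap g) (hh : IsDiskSelfMap h)
    {w z : ℂ} (hz : z ∈ 𝔻) (hne : g (h z) ≠ w) (c : 𝔻) :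
    ((analyticOrderAt (fun ζ => g ζ - w) c : ℕ∞) : ℝ≥0∞) * lindelofSum h c z
      ≤ ((analyticOrderAt (fun ζ => g ζ - w) c : ℕ∞) : ℝ≥0∞) * diskGreen (h z) c := by
  by_cases hc : h z = c
  · have : analyticOrderAt (fun ζ => g ζ - w) c = 0 := by
      rw [(hg.analyticAt_sub w c.2).analyticOrderAt_eq_zero, sub_ne_zero, ← hc]
      exact hne
    simp [this]
  · gcongr
    exact lindelofSum_le_diskGreen hh c.2 hz hc

theorem IsIndestructibleBlaschkeProduct.comp {g h : ℂ → ℂ}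
    (hg : IsIndestructibleBlaschkeProduct g) (hh : IsIndestructibleBlaschkeProduct h)
    (hne : ∀ w, ∃ z ∈ 𝔻, g (h z) ≠ w) : IsIndestructibleBlaschkeProduct (g ∘ h) := by
  have hgs := hg.1.1
  have hhs := hh.1.1
  refine isIndestructibleBlaschkeProduct_of_diskGreen_le (hgs.comp hhs) fun w hw => ?_
  obtain ⟨z, hz, hzw⟩ := hne w
  refine ⟨z, hz, hzw, (hg.diskGreen_le hw (hhs.2 hz) hzw).trans ?_⟩
  rw [lindelofSum_comp hgs hhs]
  refine ENNReal.tsum_le_tsum fun c => ?_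
  by_cases hc : h z = c
  · have : analyticOrderAt (fun ζ => g ζ - w) c = 0 := by
      rw [(hgs.analyticAt_sub w c.2).analyticOrderAt_eq_zero, sub_ne_zero, ← hc]
      exact hzw
    simp [this]
  · gcongr
    exact hh.diskGreen_le c.2 hz hc

/-- Both factors of an indestructible Blaschke product are indestructible. In the chain
`diskGreen (g (h z)) w = lindelofSum (g ∘ h) w z ≤ lindelofSum g w (h z) ≤ diskGreen (g (h z)) w`
equality must hold throughout, and hence in each term of the first inequality. -/
theorem IsIndestructibleBlaschkeProduct.of_comp {g h : ℂ → ℂ} (hg : IsDiskSelfMap g)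
    (hh : IsDiskSelfMap h) (hgh : IsIndestructibleBlaschkeProduct (g ∘ h)) :
    IsIndestructibleBlaschkeProduct g ∧ IsIndestructibleBlaschkeProduct h := by
  constructor
  · refine isIndestructibleBlaschkeProduct_of_diskGreen_le hg fun w hw => ?_
    obtain ⟨z, hz, hne⟩ := hgh.exists_ne w
    refine ⟨h z, hh.2 hz, hne, (hgh.diskGreen_le hw hz hne).trans ?_⟩
    rw [lindelofSum_comp hg hh]
    exact ENNReal.tsum_le_tsum (order_mul_lindelofSum_le hg hh hz hne)
  · refine isIndestructibleBlaschkeProduct_of_diskGreen_le hh fun c hc => ?_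
    obtain ⟨z, hz, hne⟩ := hgh.exists_ne (g c)
    have hzc : h z ≠ c := fun e => hne (congrArg g e)
    refine ⟨z, hz, hzc, ?_⟩
    by_contra! hlt
    -- A strict inequality for the value `c` of `h` gives one for the value `g c` of `g ∘ h`.
    have hGL := lindelofSum_le_diskGreen hg (hg.2 hc) (hh.2 hz) hne
    have hfin : lindelofSum g (g c) (h z) ≠ ∞ :=
      (hGL.trans_lt (diskGreen_ne_top _ _).lt_top).ne
    set m : ℝ≥0∞ := ((analyticOrderAt (fun ζ => g ζ - g c) c : ℕ∞) : ℝ≥0∞) with hm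
    have hm0 : m ≠ 0 := by
      rw [hm, Ne, ENat.toENNReal_eq_zero, (hg.analyticAt_sub _ hc).analyticOrderAt_eq_zero]
      simp
    -- An infinite multiplicity would make the Lindelöf sum of `g` infinite.
    have hmtop : m ≠ ∞ := fun e => by
      have h1 : m * diskGreen (h z) c ≠ ∞ :=
        ne_top_of_le_ne_top hfin (ENNReal.le_tsum (⟨c, hc⟩ : 𝔻))
      rw [e, ENNReal.top_mul (diskGreen_ne_zero hc (hh.2 hz) hzc)] at h1
      exact h1 rfl
    have hstrict : lindelofSum (g ∘ h) (g c) z < lindelofSum g (g c) (h z) := by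
      rw [lindelofSum_comp hg hh]
      refine ENNReal.tsum_lt_tsum (i := (⟨c, hc⟩ : 𝔻)) ?_
        (order_mul_lindelofSum_le hg hh hz hne) (ENNReal.mul_lt_mul_right hm0 hmtop hlt)
      exact ne_top_of_le_ne_top hfin
        (ENNReal.tsum_le_tsum (order_mul_lindelofSum_le hg hh hz hne))
    exact absurd (hgh.diskGreen_le (hg.2 hc) hz hne) (not_le.mpr (hstrict.trans_le hGL))

/-! ### Tails of forward iterates -/

lemma IsSchur.isDiskSelfMap {f : ℂ → ℂ} (hf : IsSchur f) {u : ℂ} (hu : u ∈ 𝔻) (hfu : ‖f u‖ < 1) :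
    IsDiskSelfMap f := by
  refine ⟨hf.1, fun v hv => mem_ball_zero_iff.mpr ((hf.norm_le hv).lt_of_ne fun h => ?_)⟩
  have h1 := hf.norm_sub_le_of_near_unimodular hu hv
  rw [h, one_pow, sub_self, mul_zero, norm_le_zero_iff, sub_eq_zero] at h1
  rw [← h1, h] at hfu
  exact lt_irrefl _ hfu

lemma IsDiskSelfMap.isOpen_image {f : ℂ → ℂ} (hf : IsDiskSelfMap f)
    (hne : ∀ w, ∃ z ∈ 𝔻, f z ≠ w) : IsOpen (f '' 𝔻) := by
  rcases (hf.1.analyticOnNhd isOpen_ball).is_constant_or_isOpen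
    (convex_ball (0 : ℂ) 1).isPreconnected with ⟨w, hw⟩ | h
  · obtain ⟨z, hz, hzw⟩ := hne w
    exact absurd (hw z hz) hzw
  · exact h 𝔻 subset_rfl isOpen_ball

/-- The composition `b (n + m) ∘ ⋯ ∘ b (n + 1)` of `m` maps. -/
def tailIterate (b : ℕ → ℂ → ℂ) (n : ℕ) : ℕ → ℂ → ℂ
  | 0 => id
  | m + 1 => b (n + m + 1) ∘ tailIterate b n m

lemma tailIterate_comp_forwardIterate (b : ℕ → ℂ → ℂ) (n m : ℕ) :
    tailIterate b n m ∘ forwardIterate b n = forwardIterate b (n + m) := by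
  induction m with
  | zero => rfl
  | succ m ih => rw [tailIterate, Function.comp_assoc, ih]; rfl

section ForwardIterates

variable {b : ℕ → ℂ → ℂ} {B : ℂ → ℂ}

lemma isDiskSelfMap_forwardIterate (hb : ∀ n, IsDiskSelfMap (b n)) (n : ℕ) :
    IsDiskSelfMap (forwardIterate b n) := by
  induction n with
  | zero => exact hb 0
  | succ n ih => exact (hb (n + 1)).comp ih

lemma isDiskSelfMap_tailIterate (hb : ∀ n, IsDiskSelfMap (b n)) (n m : ℕ) :
    IsDiskSelfMap (tailIterate b n m) := by
  induction m with
  | zero => exact ⟨differentiableOn_id, mapsTo_id _⟩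
  | succ m ih => exact (hb (n + m + 1)).comp ih

lemma tendsto_tailIterate
    (hlim : ∀ z ∈ 𝔻, Tendsto (fun n => forwardIterate b n z) atTop (𝓝 (B z))) (n : ℕ) {z : ℂ}
    (hz : z ∈ 𝔻) :
    Tendsto (fun m => tailIterate b n m (forwardIterate b n z)) atTop (𝓝 (B z)) := by
  have h := (tendsto_add_atTop_iff_nat n).mpr (hlim z hz)
  refine h.congr fun m => ?_
  rw [add_comm, ← tailIterate_comp_forwardIterate, Function.comp_apply]

lemma exists_forwardIterate_ne
    (hlim : ∀ z ∈ 𝔻, Tendsto (fun n => forwardIterate b n z) atTop (𝓝 (B z)))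
    (hne : ∀ w, ∃ z ∈ 𝔻, B z ≠ w) (n : ℕ) (w : ℂ) : ∃ z ∈ 𝔻, forwardIterate b n z ≠ w := by
  by_contra! h
  have h0 : (0 : ℂ) ∈ 𝔻 := mem_ball_self one_pos
  obtain ⟨z, hz, hz0⟩ := hne (B 0)
  have h1 := tendsto_tailIterate hlim n hz
  rw [h z hz, ← h 0 h0] at h1
  exact hz0 (tendsto_nhds_unique h1 (tendsto_tailIterate hlim n h0))

/-- The tails of the forward iterates converge, so every forward iterate is a right factor of the
limit. -/
lemma exists_comp_forwardIterate_eq (hb : ∀ n, IsDiskSelfMap (b n)) (hB : IsDiskSelfMap B)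
    (hlim : ∀ z ∈ 𝔻, Tendsto (fun n => forwardIterate b n z) atTop (𝓝 (B z)))
    (hne : ∀ w, ∃ z ∈ 𝔻, B z ≠ w) (n : ℕ) :
    ∃ C, IsDiskSelfMap C ∧ EqOn B (C ∘ forwardIterate b n) 𝔻 := by
  have h0 : (0 : ℂ) ∈ 𝔻 := mem_ball_self one_pos
  have hBn := isDiskSelfMap_forwardIterate hb n
  obtain ⟨C, hC, hlimC⟩ := exists_tendstoLocallyUniformlyOn_of_isSchur
    (fun m => (isDiskSelfMap_tailIterate hb n m).isSchur)
    (hBn.isOpen_image (exists_forwardIterate_ne hlim hne n)) hBn.2.image_subset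
    ⟨_, mem_image_of_mem _ h0⟩ (by
      rintro _ ⟨z, hz, rfl⟩
      exact ⟨_, tendsto_tailIterate hlim n hz⟩)
  have heq : EqOn B (C ∘ forwardIterate b n) 𝔻 := fun z hz =>
    tendsto_nhds_unique (tendsto_tailIterate hlim n hz) (hlimC.tendsto_at (hBn.2 hz))
  refine ⟨C, hC.isDiskSelfMap (hBn.2 h0) ?_, heq⟩
  rw [← Function.comp_apply (f := C), ← heq h0]
  exact mem_ball_zero_iff.mp (hB.2 h0)

/-- The limits of the tails of the forward iterates tend to the identity. -/
lemma tendstoLocallyUniformlyOn_id_of_comp_forwardIterate_eq (hb : ∀ n, IsDiskSelfMap (b n))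
    (hB : IsDiskSelfMap B)
    (hlim : ∀ z ∈ 𝔻, Tendsto (fun n => forwardIterate b n z) atTop (𝓝 (B z)))
    (hne : ∀ w, ∃ z ∈ 𝔻, B z ≠ w) {C : ℕ → ℂ → ℂ} (hC : ∀ n, IsDiskSelfMap (C n))
    (hBC : ∀ n, EqOn B (C n ∘ forwardIterate b n) 𝔻) :
    TendstoLocallyUniformlyOn C id atTop 𝔻 := by
  have hopen := hB.isOpen_image hne
  have hpt : ∀ u ∈ B '' 𝔻, Tendsto (fun n => C n u) atTop (𝓝 u) := by
    rintro _ ⟨z, hz, rfl⟩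
    rw [tendsto_iff_norm_sub_tendsto_zero]
    -- `C n` takes the value `B z` at the point `forwardIterate b n z`, which is close to `B z`.
    have h1 : Tendsto (fun n => 2 * ‖diskInvolution (B z) (forwardIterate b n z)‖) atTop
        (𝓝 0) := by
      have hc := (differentiableOn_diskInvolution (hB.2 hz)).continuousOn.continuousAt
        (isOpen_ball.mem_nhds (hB.2 hz))
      simpa using ((hc.tendsto.comp (hlim z hz)).norm.const_mul 2)
    refine squeeze_zero (fun _ => norm_nonneg _) (fun n => ?_) h1
    have hBn := (isDiskSelfMap_forwardIterate hb n).2 hz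
    have h2 := (hC n).isSchur.norm_sub_le_two_mul hBn (hB.2 hz)
    have e : B z = C n (forwardIterate b n z) := hBC n hz
    rwa [← e] at h2
  obtain ⟨F, hF, hCF⟩ := exists_tendstoLocallyUniformlyOn_of_isSchur (fun n => (hC n).isSchur)
    hopen hB.2.image_subset ⟨_, mem_image_of_mem _ (mem_ball_self one_pos)⟩
    fun u hu => ⟨u, hpt u hu⟩
  refine hCF.congr_right ?_
  have hB0 := hB.2 (mem_ball_self one_pos)
  refine (hF.1.analyticOnNhd isOpen_ball).eqOn_of_preconnected_of_eventuallyEq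
    analyticOnNhd_id (convex_ball (0 : ℂ) 1).isPreconnected hB0 ?_
  filter_upwards [hopen.mem_nhds (mem_image_of_mem _ (mem_ball_self one_pos))] with u hu
  exact tendsto_nhds_unique (hCF.tendsto_at (hB.2.image_subset hu)) (hpt u hu)

end ForwardIterates

/-- Maps close to the identity attain every value near that value. -/
lemma eventually_exists_eq_of_tendstoLocallyUniformlyOn_id {C : ℕ → ℂ → ℂ}
    (hC : ∀ n, IsDiskSelfMap (C n)) (hid : TendstoLocallyUniformlyOn C id atTop 𝔻) {w : ℂ}
    (hw : w ∈ 𝔻) {V : Set ℂ} (hV : V ∈ 𝓝 w) : ∀ᶠ n in atTop, ∃ c ∈ V ∩ 𝔻, C n c = w := by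
  obtain ⟨δ, hδ, hsub⟩ := nhds_basis_closedBall.mem_iff.mp
    (inter_mem hV (isOpen_ball.mem_nhds hw))
  have hsub' : closedBall w δ ⊆ 𝔻 := hsub.trans inter_subset_right
  have hunif := (tendstoLocallyUniformlyOn_iff_forall_isCompact isOpen_ball).mp hid _ hsub'
    (isCompact_closedBall w δ)
  filter_upwards [Metric.tendstoUniformlyOn_iff.mp hunif (δ / 4) (by positivity)] with n hn
  have hnw := hn w (mem_closedBall_self hδ.le)
  rw [id, dist_eq_norm] at hnw
  have hsphere : ∀ z ∈ sphere w δ, δ / 2 ≤ ‖C n z - C n w‖ := by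
    intro z hz
    have hnz := hn z (sphere_subset_closedBall hz)
    rw [id, dist_eq_norm] at hnz
    rw [mem_sphere_iff_norm] at hz
    have h1 : z - w = (z - C n z) + (C n z - C n w) - (w - C n w) := by ring
    have h2 := norm_sub_le ((z - C n z) + (C n z - C n w)) (w - C n w)
    have h3 := norm_add_le (z - C n z) (C n z - C n w)
    rw [← h1, hz] at h2
    linarith
  have hfreq : ∃ᶠ z in 𝓝 w, C n z ≠ C n w := by
    intro hev
    have hconst := ((hC n).1.analyticOnNhd isOpen_ball).eqOn_of_preconnected_of_eventuallyEq
      analyticOnNhd_const (convex_ball (0 : ℂ) 1).isPreconnected hw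
      (hev.mono fun z hz => not_not.mp hz)
    obtain ⟨z, hz⟩ : (sphere w δ).Nonempty := NormedSpace.sphere_nonempty.mpr hδ.le
    have h := hsphere z hz
    rw [hconst (hsub' (sphere_subset_closedBall hz)), sub_self, norm_zero] at h
    linarith
  have himage := (((hC n).1.mono hsub').diffContOnCl_ball subset_rfl).ball_subset_image_closedBall
    hδ hsphere hfreq
  obtain ⟨c, hc, hcw⟩ := himage (show w ∈ ball (C n w) (δ / 2 / 2) by
    rw [mem_ball_iff_norm]; linarith)
  exact ⟨c, hsub hc, hcw⟩

theorem mainTheorem2 (b : ℕ → ℂ → ℂ) (hb : ∀ n, IsDiskSelfMap (b n))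
    (B : ℂ → ℂ) (hB : IsDiskSelfMap B)
    (hlim : ∀ z ∈ Metric.ball (0 : ℂ) 1,
      Filter.Tendsto (fun n => forwardIterate b n z) Filter.atTop (nhds (B z)))
    (hnonconst : ¬ ∃ c : ℂ, ∀ z ∈ Metric.ball (0 : ℂ) 1, B z = c) :
    (∀ n, IsIndestructibleBlaschkeProduct (b n)) ↔ IsIndestructibleBlaschkeProduct B := by
  have hne : ∀ w, ∃ z ∈ 𝔻, B z ≠ w := by
    intro w
    by_contra! h
    exact hnonconst ⟨w, h⟩
  have hBn := isDiskSelfMap_forwardIterate hb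
  choose C hC hBC using exists_comp_forwardIterate_eq hb hB hlim hne
  constructor
  · intro hind
    have hBnind : ∀ n, IsIndestructibleBlaschkeProduct (forwardIterate b n) := by
      intro n
      induction n with
      | zero => exact hind 0
      | succ n ih => exact (hind (n + 1)).comp ih (exists_forwardIterate_ne hlim hne (n + 1))
    have hid := tendstoLocallyUniformlyOn_id_of_comp_forwardIterate_eq hb hB hlim hne hC hBC
    refine isIndestructibleBlaschkeProduct_of_diskGreen_le hB fun w hw => ?_
    obtain ⟨z, hz, hzw⟩ := hne w
    refine ⟨z, hz, hzw, le_of_forall_lt fun K hK => ?_⟩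
    have hcont := continuousAt_diskGreen (hB.2 hz) hw hzw
    have hnear : ∀ᶠ p : ℂ × ℂ in 𝓝 (B z, w), K < diskGreen p.1 p.2 ∧ p.1 ≠ p.2 :=
      (hcont.eventually_const_lt hK).and
        ((isOpen_ne_fun continuous_fst continuous_snd).mem_nhds hzw)
    rw [nhds_prod_eq] at hnear
    obtain ⟨p, hp, q, hq, hpq⟩ := eventually_prod_iff.mp hnear
    -- The limit `C n` of the tails takes the value `w` at a point `c` near `w`.
    obtain ⟨n, hn, c, hc, hcw⟩ := (((hlim z hz).eventually hp).and
      (eventually_exists_eq_of_tendstoLocallyUniformlyOn_id hC hid hw hq)).exists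
    obtain ⟨hlt, hnec⟩ := hpq hn hc.1
    calc K < diskGreen (forwardIterate b n z) c := hlt
      _ ≤ lindelofSum (forwardIterate b n) c z := (hBnind n).diskGreen_le hc.2 hz hnec
      _ ≤ lindelofSum (C n ∘ forwardIterate b n) w z :=
        lindelofSum_le_lindelofSum_comp (hC n) (hBn n) hc.2 hcw z
      _ = lindelofSum B w z := (lindelofSum_congr (hBC n) w z).symm
  · intro hBind
    have hBnind : ∀ n, IsIndestructibleBlaschkeProduct (forwardIterate b n) := fun n =>
      ((hBind.congr (hBC n)).of_comp (hC n) (hBn n)).2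
    intro n
    cases n with
    | zero => exact hBnind 0
    | succ n => exact ((hBnind (n + 1)).of_comp (hb (n + 1)) (hBn n)).1
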